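/- Let $f\in C^1[0,\infty)$ with $f>0$ on $[0,\infty)$, and put $g=\log f$ and $H=\dfrac{g\,g''}{(g')^2}$. Assume: (G1) $g(s)>0$ and $\int_s^\infty \frac{du}{g(u)}<\infty$ for all large $s$, and $\lim_{s\to\infty}H(s)=\frac1q$ exists; (G2) there are $C_0>0$ and $s_0>0$ such that $g\in C^5(s_0,\infty)$ and $|H^{(k)}(s)|<C_0\left(\frac{g'(s)}{g(s)}\right)^k$ for all $k\in\{1,2,3\}$ and $s>s_0$. Assume moreover that $1\le q<2$. A singular solution of the Emden–Fowler equation $$-\frac{d^2z}{d\rho^2}=\frac14 f(z)e^{-\rho}\tag{1}$$ is a function $z$ that is of class $C^2$ and satisfies (1) on some half-line $(\Lambda,\infty)$, with $z(\rho)\to\infty$ as $\rho\to\infty$. Let $y_\infty$ be a singular solution of (1) such that, for some $\varepsilon_0\in(0,\frac12]$, $$g(y_\infty(\rho))=\rho-2\log\rho+\log\left[\tfrac{g}{g'}(g^{-1}(\rho))\right]+\log4-\log q+\log\left(qH(g^{-1}(\rho))\right)+o(\rho^{-1+\varepsilon_0})\qquad(\rho\to\infty),$$ where $g^{-1}$ is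 the inverse function of $g$ near infinity. For $\varepsilon\in(0,1)$ and $C>0$ put $$\mathcal F(s)=g(s)+2\log g(s)-\log\frac{g(s)}{g'(s)}-\log(4H(s))-\frac{C}{g(s)^{1-\varepsilon}}$$ for large $s$. **Theorem 4.1.** There is a constant $C_1>0$ depending only on $f$ (not on $\varepsilon$, $C$, $y_\infty$ or $z_\infty$) such that, for all $\varepsilon\in(0,1)$ and $C>0$, every $y_\infty$ as above and every singular solution $z_\infty$ of (1), at least one of the following holds: (i) there is a sequence $\rho_n\to\infty$ such that $g(y_\infty(\rho_n))\le g(z_\infty(\rho_n))$ for all $n$; (ii) $\mathcal F(z_\infty(\rho))-\rho>-C_1$ for all sufficiently large $\rho$; (iii) there is a sequence $\rho_n\to\infty$ such that $\mathcal F(z_\infty(\rho_n))>\rho_n\ge\mathcal F(y_\infty(\rho_n))$ for all $n$. -/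

import Mathlib

open Real Set Filter Topology MeasureTheory Asymptotics

noncomputable section

namespace EmdenFowler

/-- The function `g = log f`. -/
def g (f : ℝ → ℝ) (s : ℝ) : ℝ := Real.log (f s)

/-- The function `H = g g'' / (g')²`. -/
def H (f : ℝ → ℝ) (s : ℝ) : ℝ :=
  g f s * deriv (deriv (g f)) s / (deriv (g f) s) ^ 2

/-- The standing assumption on the nonlinearity: `f ∈ C¹[0, ∞)` and `f > 0` on `[0, ∞)`. -/
structure IsNonlinearity (f : ℝ → ℝ) : Prop where
  contDiffOn : ContDiffOn ℝ 1 f (Ici 0)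
  pos : ∀ s, 0 ≤ s → 0 < f s

/-- Condition (G1): near infinity `g` is positive and `1 / g` is integrable, and
`H(s) → 1 / q` as `s → ∞`. -/
structure G1 (f : ℝ → ℝ) (q : ℝ) : Prop where
  pos : ∀ᶠ s in atTop, 0 < g f s
  integrable : ∀ᶠ s in atTop, IntegrableOn (fun u => 1 / g f u) (Ioi s)
  tendsto : Tendsto (H f) atTop (𝓝 (1 / q))

/-- Condition (G2): for some `C, s₀ > 0`, `g ∈ C⁵(s₀, ∞)` and `|H⁽ᵏ⁾| < C (g' / g)ᵏ` on
`(s₀, ∞)` for `k = 1, 2, 3`. -/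
def G2 (f : ℝ → ℝ) : Prop :=
  ∃ C > 0, ∃ s₀ > 0, ContDiffOn ℝ 5 (g f) (Ioi s₀) ∧
    ∀ k ∈ Finset.Icc 1 3, ∀ s > s₀,
      |iteratedDeriv k (H f) s| < C * (deriv (g f) s / g f s) ^ k

/-- `z` is a singular solution of the Emden-Fowler equation `- z'' = (1/4) f(z) e^{-ρ}`: it is
of class `C²` and solves the equation on some half-line `(Λ, ∞)`, and `z(ρ) → ∞` as `ρ → ∞`. -/
def IsSingularSolution (f z : ℝ → ℝ) : Prop :=
  (∃ Λ : ℝ, ContDiffOn ℝ 2 z (Ioi Λ) ∧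
    ∀ ρ > Λ, - deriv (deriv z) ρ = 1 / 4 * f (z ρ) * Real.exp (-ρ)) ∧
  Tendsto z atTop atTop

/-- `γ` is the inverse function of `g` near infinity. -/
def IsInverseNearInfinity (g γ : ℝ → ℝ) : Prop :=
  Tendsto γ atTop atTop ∧ ∀ᶠ ρ in atTop, g (γ ρ) = ρ

/-- `y` is a distinguished singular solution: for some `ε ∈ (0, 1/2]`, as `ρ → ∞`,
`g(y(ρ)) = ρ - 2 log ρ + log [(g/g')(g⁻¹(ρ))] + log 4 - log q + log (q H(g⁻¹(ρ))) + o(ρ^{-1+ε})`.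
The case `ε = 1/2` is the weakest, so any such `y` is covered by it. -/
def IsDistinguishedSolution (f : ℝ → ℝ) (q : ℝ) (y : ℝ → ℝ) : Prop :=
  IsSingularSolution f y ∧
  ∃ γ : ℝ → ℝ, IsInverseNearInfinity (g f) γ ∧
  ∃ ε : ℝ, 0 < ε ∧ ε ≤ 1 / 2 ∧
    (fun ρ : ℝ => g f (y ρ) -
        (ρ - 2 * Real.log ρ + Real.log (g f (γ ρ) / deriv (g f) (γ ρ))
          + Real.log 4 - Real.log q + Real.log (q * H f (γ ρ))))
      =o[atTop] fun ρ : ℝ => ρ ^ (-1 + ε)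

/-- The function
`𝓕(s) = g(s) + 2 log g(s) - log (g(s) / g'(s)) - log (4 H(s)) - C / g(s)^{1-ε}`. -/
def F (f : ℝ → ℝ) (ε C : ℝ) (s : ℝ) : ℝ :=
  g f s + 2 * Real.log (g f s) - Real.log (g f s / deriv (g f) s)
    - Real.log (4 * H f s) - C / (g f s) ^ (1 - ε)

end EmdenFowler

end

/-!
The proof follows `w = g(z)` and `U = w - ρ + log w + log g'(z)` along a singular solution `z`; here
`exp U = f(z) e^{-ρ} g(z) g'(z)`, and `U` differs from `𝓕(z) - ρ` by a bounded amount. With `p = w'`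
and `h = H(z)` the Emden-Fowler equation becomes
`p' = (h p² - exp U / 4) / w`, `U' = p (1 + (1 + h) / w) - 1`.
Since `w` is large, this is a slowly varying, weakly anti-damped oscillator for `U` on the time
scale `√w`: an orbit coming from very negative values of `U` swings up to correspondingly large
values. Quantitatively, if eventually `U ≤ 3`, then eventually `U > -1000`
(`IsReducedOrbit.lt_U_of_le_three`). Three facts make this work. A deep excursion cannot last
forever (`exists_turning_point`), because `w → ∞`; while `U` climbs to `-3` it gathers speed
(`exists_fast_ascent`); and this speed carries it beyond `3` (`exists_three_lt`).

If the first alternative fails, then eventually `g(z) < g(y)` for the distinguished solution `y`,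
hence `z ≤ y`. As `g` and `g'` are increasing, the level `U` of `z` is at most that of `y`, and the
expansion of `g(y)` bounds the latter by `log 4` plus a vanishing error
(`IsDistinguishedSolution.eventually_level_le`). So the upper bound `U ≤ 3` holds and gives the
second alternative; the third one is never needed.
-/

namespace EmdenFowler

/-! ### First hitting times and monotonicity from derivative bounds -/

theorem exists_first_ge {φ : ℝ → ℝ} {a d c : ℝ} (hφ : ContinuousOn φ (Icc a d)) (had : a ≤ d)
    (hd : c ≤ φ d) : ∃ b ∈ Icc a d, c ≤ φ b ∧ ∀ x ∈ Ico a b, φ x < c := by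
  have hcl : IsClosed (Icc a d ∩ φ ⁻¹' Ici c) :=
    hφ.preimage_isClosed_of_isClosed isClosed_Icc isClosed_Ici
  have hbdd : BddBelow (Icc a d ∩ φ ⁻¹' Ici c) := ⟨a, fun x hx => hx.1.1⟩
  have hmem := hcl.csInf_mem ⟨d, ⟨had, le_rfl⟩, hd⟩ hbdd
  refine ⟨_, hmem.1, hmem.2, fun x hx => ?_⟩
  by_contra! h
  exact absurd (csInf_le hbdd ⟨⟨hx.1, hx.2.le.trans hmem.1.2⟩, h⟩) (not_le.2 hx.2)

theorem sub_le_of_hasDerivAt_le {φ φ' : ℝ → ℝ} {a b C : ℝ} (hab : a ≤ b)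
    (hφ : ∀ x ∈ Icc a b, HasDerivAt φ (φ' x) x) (hC : ∀ x ∈ Ioo a b, φ' x ≤ C) :
    φ b - φ a ≤ C * (b - a) := by
  refine Convex.image_sub_le_mul_sub_of_deriv_le (convex_Icc a b)
    (fun x hx => (hφ x hx).continuousAt.continuousWithinAt) ?_ ?_ a (left_mem_Icc.2 hab) b
    (right_mem_Icc.2 hab) hab <;> rw [interior_Icc] <;> intro x hx
  · exact (hφ x (Ioo_subset_Icc_self hx)).differentiableAt.differentiableWithinAt
  · rw [(hφ x (Ioo_subset_Icc_self hx)).deriv]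
    exact hC x hx

theorem le_sub_of_le_hasDerivAt {φ φ' : ℝ → ℝ} {a b C : ℝ} (hab : a ≤ b)
    (hφ : ∀ x ∈ Icc a b, HasDerivAt φ (φ' x) x) (hC : ∀ x ∈ Ioo a b, C ≤ φ' x) :
    C * (b - a) ≤ φ b - φ a := by
  have := sub_le_of_hasDerivAt_le (C := -C) hab (fun x hx => (hφ x hx).neg)
    (fun x hx => neg_le_neg (hC x hx))
  simp only [Pi.neg_apply] at this
  linarith

/-- A function whose derivative is nonnegative wherever its value exceeds `c` never falls below
an initial value exceeding `c`. -/
theorem le_of_hasDerivAt_nonneg_of_lt {φ φ' : ℝ → ℝ} {a b c : ℝ} (hab : a ≤ b)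
    (hφ : ∀ x ∈ Icc a b, HasDerivAt φ (φ' x) x) (ha : c < φ a)
    (h : ∀ x ∈ Ico a b, c < φ x → 0 ≤ φ' x) : φ a ≤ φ b := by
  by_contra! hlt
  obtain ⟨y, hy, hcy, hbefore⟩ := exists_first_ge (φ := fun x => -φ x) (c := -max c (φ b))
    (fun x hx => (hφ x hx).continuousAt.continuousWithinAt.neg) hab (neg_le_neg (le_max_right _ _))
  have := le_sub_of_le_hasDerivAt (C := 0) hy.1 (fun x hx => hφ x ⟨hx.1, hx.2.trans hy.2⟩)
    (fun x hx => h x ⟨hx.1.le, hx.2.trans_le hy.2⟩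
      ((le_max_left _ _).trans_lt (neg_lt_neg_iff.1 (hbefore x (Ioo_subset_Ico_self hx)))))
  have h2 := max_lt ha hlt
  have h3 := neg_le_neg_iff.1 hcy
  linarith

/-! ### The reduced system -/

/-- An orbit on `[R, ∞)` of the system satisfied by `w = g ∘ z`, `p = w'` and
`U = w - ρ + log w + log (g' ∘ z)`, where `z` is a singular solution and `h = H ∘ z`. The bound
`10 ^ 6 ≤ w` fixes a meaning of "near infinity". -/
structure IsReducedOrbit (w p U h : ℝ → ℝ) (R : ℝ) : Prop where
  hasDerivAt_w : ∀ x, R ≤ x → HasDerivAt w (p x) x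
  hasDerivAt_p : ∀ x, R ≤ x → HasDerivAt p ((h x * p x ^ 2 - exp (U x) / 4) / w x) x
  hasDerivAt_U : ∀ x, R ≤ x → HasDerivAt U (p x * (1 + (1 + h x) / w x) - 1) x
  le_h : ∀ x, R ≤ x → 1 / 2 ≤ h x
  h_le : ∀ x, R ≤ x → h x ≤ 2
  le_w : ∀ x, R ≤ x → 10 ^ 6 ≤ w x
  p_pos : ∀ x, R ≤ x → 0 < p x
  tendsto_w : Tendsto w atTop atTop

namespace IsReducedOrbit

variable {w p U h : ℝ → ℝ} {R : ℝ}

theorem w_le_w (S : IsReducedOrbit w p U h R) {a b : ℝ} (ha : R ≤ a) (hab : a ≤ b) :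
    w a ≤ w b := by
  have := le_sub_of_le_hasDerivAt (C := 0) hab (fun x hx => S.hasDerivAt_w x (ha.trans hx.1))
    (fun x hx => (S.p_pos x (ha.trans hx.1.le)).le)
  linarith

theorem sub_one_le_deriv_U (S : IsReducedOrbit w p U h R) {x : ℝ} (hx : R ≤ x) :
    p x - 1 ≤ p x * (1 + (1 + h x) / w x) - 1 := by
  have h1 := S.p_pos x hx
  have h2 := S.le_w x hx
  have h3 := S.le_h x hx
  have : 0 ≤ p x * ((1 + h x) / w x) := mul_nonneg h1.le (div_nonneg (by linarith) (by linarith))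
  linarith

theorem deriv_U_le (S : IsReducedOrbit w p U h R) {x : ℝ} (hx : R ≤ x) :
    p x * (1 + (1 + h x) / w x) - 1 ≤ p x * (1 + 3 / w x) - 1 := by
  have h1 := S.p_pos x hx
  have h2 := S.le_w x hx
  have h3 := S.h_le x hx
  have : (1 + h x) / w x ≤ 3 / w x := by
    apply div_le_div_of_nonneg_right <;> linarith
  have := mul_le_mul_of_nonneg_left this h1.le
  linarith

/-- If the term `exp U / 4` is so small that `p' ≥ p² / (4 w)` from some point on, then `p`
dominates a multiple of `w ^ (1/4)` and hence tends to infinity. -/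
theorem tendsto_p_of_le (S : IsReducedOrbit w p U h R) {a : ℝ} (ha : R ≤ a)
    (hle : ∀ x, a ≤ x → p x ^ 2 / 4 ≤ h x * p x ^ 2 - exp (U x) / 4) :
    Tendsto p atTop atTop := by
  have key : ∀ x, a ≤ x → log (p a) - 1 / 4 * log (w a) + 1 / 4 * log (w x) ≤ log (p x) := by
    intro x hx
    have := le_sub_of_le_hasDerivAt (C := 0) (φ := fun x => log (p x) - 1 / 4 * log (w x)) hx
      (fun y hy => ((S.hasDerivAt_p y (ha.trans hy.1)).log (S.p_pos y (ha.trans hy.1)).ne').sub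
        (((S.hasDerivAt_w y (ha.trans hy.1)).log
          (by linarith [S.le_w y (ha.trans hy.1)])).const_mul (1 / 4))) ?_
    · linarith
    · intro y hy
      have hRy := ha.trans hy.1.le
      have h1 := S.p_pos y hRy
      have h2 : 0 < w y := by linarith [S.le_w y hRy]
      have h3 := hle y hy.1.le
      have e : (h y * p y ^ 2 - exp (U y) / 4) / w y / p y - 1 / 4 * (p y / w y)
          = (h y * p y ^ 2 - exp (U y) / 4 - p y ^ 2 / 4) / (w y * p y) := by
        field_simp
      rw [e]
      exact div_nonneg (by linarith) (by positivity)
  have hlog : Tendsto (fun x => log (p x)) atTop atTop := by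
    refine tendsto_atTop_mono' _ ((eventually_ge_atTop a).mono key) ?_
    exact tendsto_atTop_add_const_left _ _
      ((tendsto_log_atTop.comp S.tendsto_w).const_mul_atTop (by norm_num))
  refine (tendsto_exp_atTop.comp hlog).congr' ?_
  filter_upwards [eventually_ge_atTop a] with x hx
  exact exp_log (S.p_pos x (ha.trans hx))

/-- Below level `-1000` the function `U` cannot decrease forever: the conclusion is the failure of
the bound `p (1 + 3 / w) < 1`, under which `U' < 0`. Otherwise either `p² > exp U` at some point,
and then `p → ∞`; or `p` decays exponentially, and then `w` is bounded. -/
theorem exists_ge_one_of_le (S : IsReducedOrbit w p U h R) {a : ℝ} (ha : R ≤ a)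
    (hUa : U a ≤ -1000) : ∃ x, a ≤ x ∧ 1 ≤ p x * (1 + 3 / w x) := by
  by_contra! hcon
  have hlt : ∀ x, a ≤ x → p x < 1 := by
    intro x hx
    have h1 := S.p_pos x (ha.trans hx)
    have h2 := S.le_w x (ha.trans hx)
    have h3 : 0 < p x * (3 / w x) := by positivity
    have := hcon x hx
    linarith
  have hU' : ∀ x, a ≤ x → p x * (1 + (1 + h x) / w x) - 1 ≤ 0 := fun x hx => by
    linarith [hcon x hx, S.deriv_U_le (ha.trans hx)]
  by_cases hbig : ∃ b, a ≤ b ∧ exp (U b) < p b ^ 2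
  · -- `p² - exp U` increases as long as it is positive, so `p` runs away.
    obtain ⟨b, hab, hb⟩ := hbig
    have hRb := ha.trans hab
    have hpers : ∀ x, b ≤ x → exp (U x) < p x ^ 2 := by
      intro x hx
      have := le_of_hasDerivAt_nonneg_of_lt (φ := fun x => p x ^ 2 - exp (U x)) (c := 0) hx
        (fun y hy => ((S.hasDerivAt_p y (hRb.trans hy.1)).pow 2).sub
          (S.hasDerivAt_U y (hRb.trans hy.1)).exp) (by linarith) ?_
      · linarith
      · intro y hy hpos
        have hRy := hRb.trans hy.1
        have h1 := S.p_pos y hRy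
        have h2 : 0 < w y := by linarith [S.le_w y hRy]
        have h3 : 0 ≤ h y * p y ^ 2 - exp (U y) / 4 := by
          nlinarith [S.le_h y hRy, sq_nonneg (p y), exp_pos (U y)]
        have h4 := hU' y (hab.trans hy.1)
        have h5 := mul_nonneg (mul_nonneg zero_le_two h1.le) (div_nonneg h3 h2.le)
        have h6 := mul_nonneg (exp_pos (U y)).le (neg_nonneg.2 h4)
        norm_num
        nlinarith
    have ht := S.tendsto_p_of_le hRb (fun x hx => by
      nlinarith [S.le_h x (hRb.trans hx), sq_nonneg (p x), hpers x hx])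
    obtain ⟨x, hx1, hx2⟩ := ((ht.eventually_ge_atTop 1).and (eventually_ge_atTop a)).exists
    linarith [hlt x hx2]
  · -- Here `p ≤ exp (U / 2)` and `U` decreases linearly, so `w` stays bounded.
    push Not at hbig
    have hp : ∀ x, a ≤ x → p x ≤ exp (U x / 2) := by
      intro x hx
      have h1 := hbig x hx
      have h2 : exp (U x) = exp (U x / 2) ^ 2 := by
        rw [← exp_nat_mul]; congr 1; push_cast; ring
      rw [h2] at h1
      exact le_of_sq_le_sq h1 (exp_pos _).le
    have hUle : ∀ x, a ≤ x → U x ≤ -1000 := by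
      intro x hx
      have := sub_le_of_hasDerivAt_le (C := 0) hx
        (fun y hy => S.hasDerivAt_U y (ha.trans hy.1)) (fun y hy => hU' y hy.1.le)
      linarith
    have hp8 : ∀ x, a ≤ x → p x ≤ 1 / 8 := by
      intro x hx
      have h1 : exp (U x / 2) ≤ exp (-7) := exp_le_exp.2 (by linarith [hUle x hx])
      have h2 : exp (-7) ≤ 1 / 8 := by
        rw [exp_neg, ← one_div]
        exact one_div_le_one_div_of_le (by norm_num) (by linarith [add_one_le_exp (7 : ℝ)])
      linarith [hp x hx]
    have hUlin : ∀ x, a ≤ x → U x ≤ -(1 / 2) * (x - a) := by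
      intro x hx
      have := sub_le_of_hasDerivAt_le (C := -(1 / 2)) hx
        (fun y hy => S.hasDerivAt_U y (ha.trans hy.1)) (fun y hy => ?_)
      · linarith
      · have hRy := ha.trans hy.1.le
        have h1 := S.deriv_U_le hRy
        have h2 : 3 / w y ≤ 1 := by
          rw [div_le_one (by linarith [S.le_w y hRy])]
          linarith [S.le_w y hRy]
        nlinarith [hp8 y hy.1.le, S.p_pos y hRy]
    have hw : ∀ x, a ≤ x → w x ≤ w a + 4 := by
      intro x hx
      have := sub_le_of_hasDerivAt_le (C := 0) (φ := fun x => w x + 4 * exp (-(1 / 4) * (x - a))) hx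
        (fun y hy => (S.hasDerivAt_w y (ha.trans hy.1)).add
          ((((hasDerivAt_id y).sub_const a).const_mul (-(1 / 4))).exp.const_mul 4)) (fun y hy => ?_)
      · simp only [sub_self, mul_zero, exp_zero] at this
        linarith [exp_pos (-(1 / 4) * (x - a))]
      · have h1 : exp (U y / 2) ≤ exp (-(1 / 4) * (y - a)) :=
          exp_le_exp.2 (by linarith [hUlin y hy.1.le])
        simp only [id]
        linarith [hp y hy.1.le]
    obtain ⟨x, hx1, hx2⟩ :=
      ((S.tendsto_w.eventually_gt_atTop (w a + 4)).and (eventually_ge_atTop a)).exists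
    linarith [hw x hx2]

/-- Every point where `U ≤ -1000` is followed by a point where still `U ≤ -1000` but `p` is no
longer appreciably below `1`. -/
theorem exists_turning_point (S : IsReducedOrbit w p U h R) {a : ℝ} (ha : R ≤ a)
    (hUa : U a ≤ -1000) : ∃ x, a ≤ x ∧ U x ≤ -1000 ∧ 1 ≤ p x * (1 + 3 / w x) := by
  obtain ⟨d, had, hd⟩ := S.exists_ge_one_of_le ha hUa
  obtain ⟨b, hb, hcb, hbefore⟩ := exists_first_ge (φ := fun x => p x * (1 + 3 / w x)) (c := 1)
    (fun x hx => by
      have hRx := ha.trans hx.1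
      have hw : w x ≠ 0 := by linarith [S.le_w x hRx]
      have c1 := (S.hasDerivAt_p x hRx).continuousAt
      have c2 := (S.hasDerivAt_w x hRx).continuousAt
      exact (c1.mul (continuousAt_const.add (continuousAt_const.div c2 hw))).continuousWithinAt)
    had hd
  refine ⟨b, hb.1, ?_, hcb⟩
  have := sub_le_of_hasDerivAt_le (C := 0) hb.1
    (fun y hy => S.hasDerivAt_U y (ha.trans hy.1))
    (fun y hy => by linarith [hbefore y (Ioo_subset_Ico_self hy), S.deriv_U_le (ha.trans hy.1.le)])
  linarith

theorem exp_neg_three_le : exp (-3) ≤ 1 / 4 := by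
  rw [exp_neg, ← one_div]
  exact one_div_le_one_div_of_le (by norm_num) (by linarith [add_one_le_exp (3 : ℝ)])

/-- As long as `U` stays below `-3`, the term `exp U / 4` is too small to prevent `p` from
increasing. -/
theorem le_p_of_lt (S : IsReducedOrbit w p U h R) {a b : ℝ} (ha : R ≤ a) (hab : a ≤ b)
    (hpa : 9 / 10 ≤ p a) (hU : ∀ x ∈ Ico a b, U x < -3) : p a ≤ p b := by
  refine le_of_hasDerivAt_nonneg_of_lt (c := 8 / 10) hab
    (fun x hx => S.hasDerivAt_p x (ha.trans hx.1)) (by linarith) (fun x hx hp => ?_)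
  have hRx := ha.trans hx.1
  have h1 := exp_le_exp.2 (hU x hx).le
  have h2 := exp_neg_three_le
  refine div_nonneg ?_ (by linarith [S.le_w x hRx])
  nlinarith [S.le_h x hRx]

/-- When `U` climbs from below `-1000` to `-3`, it gathers speed: it arrives at `-3` with
`p - 1 ≥ 13 / √w`. On the natural time scale `√w` this is a gain of speed proportional to the
square root of the height climbed. -/
theorem exists_fast_ascent (S : IsReducedOrbit w p U h R) {a : ℝ} (ha : R ≤ a)
    (hUa : U a ≤ -1000) (hpa : 1 ≤ p a * (1 + 3 / w a)) :
    ∃ b, a ≤ b ∧ -3 ≤ U b ∧ 13 / √(w b) ≤ p b - 1 := by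
  have hwa := S.le_w a ha
  have hpa' : 1 - 3 / w a ≤ p a := by
    have h1 : 0 < 3 / w a := by positivity
    have h2 := S.p_pos a ha
    by_contra! hlt
    nlinarith
  have hsmall : 3 / w a ≤ 1 / 1000 := by
    rw [div_le_div_iff₀ (by linarith) (by norm_num)]; linarith
  have hstep : ∀ x, a ≤ x → U x < -3 → p a ≤ p x →
      p x ^ 2 / 4 ≤ h x * p x ^ 2 - exp (U x) / 4 ∧ 3 / 10 ≤ h x * p x ^ 2 - exp (U x) / 4 := by
    intro x hx hU hp
    have h1 := exp_le_exp.2 hU.le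
    have h2 := exp_neg_three_le
    constructor <;> nlinarith [S.le_h x (ha.trans hx)]
  have hex : ∃ d, a ≤ d ∧ -3 ≤ U d := by
    by_contra! hcon
    have ht := S.tendsto_p_of_le ha (fun x hx => (hstep x hx (hcon x hx)
      (S.le_p_of_lt ha hx (by linarith) (fun y hy => hcon y hy.1))).1)
    obtain ⟨X, hX⟩ := eventually_atTop.1 ((ht.eventually_ge_atTop 2).and (eventually_ge_atTop a))
    have haX := (hX X le_rfl).2
    have := le_sub_of_le_hasDerivAt (C := 1) (show X ≤ X + |U X| by linarith [abs_nonneg (U X)])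
      (fun y hy => S.hasDerivAt_U y ((ha.trans haX).trans hy.1)) (fun y hy => by
        linarith [(hX y hy.1.le).1, S.sub_one_le_deriv_U ((ha.trans haX).trans hy.1.le)])
    linarith [hcon (X + |U X|) (by linarith [abs_nonneg (U X)]), neg_abs_le (U X)]
  obtain ⟨d, had, hd⟩ := hex
  obtain ⟨b, hb, hUb, hbefore⟩ := exists_first_ge (φ := U)
    (fun x hx => (S.hasDerivAt_U x (ha.trans hx.1)).continuousAt.continuousWithinAt) had hd
  refine ⟨b, hb.1, hUb, ?_⟩
  by_contra! hslow
  have hab := hb.1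
  have hRb := ha.trans hab
  have hpmono : ∀ x ∈ Icc a b, p a ≤ p x := fun x hx => S.le_p_of_lt ha hx.1 (by linarith)
    (fun y hy => hbefore y ⟨hy.1, hy.2.trans_le hx.2⟩)
  have hpb : ∀ x ∈ Icc a b, p x ≤ p b := fun x hx => S.le_p_of_lt (ha.trans hx.1) hx.2
    (by linarith [hpmono x hx]) (fun y hy => hbefore y ⟨hx.1.trans hy.1, hy.2⟩)
  have hwb := S.w_le_w ha hab
  set r := √(w b) with hr
  have hrr : r ^ 2 = w b := sq_sqrt (by linarith)
  have hr1000 : 1000 ≤ r := by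
    rw [hr]; apply le_sqrt_of_sq_le; linarith
  have hinv : 13 / r ≤ 13 / 1000 := div_le_div_of_nonneg_left (by norm_num) (by norm_num) hr1000
  -- The bound `p' ≥ 3 / (10 w)` would push `p` beyond `1 + 13 / √w` in a time of order `√w`, so
  -- a slow ascent has to end before that.
  have e1 : (3 / 10 / w b) * (b - a) ≤ p b - p a :=
    le_sub_of_le_hasDerivAt hab (fun x hx => S.hasDerivAt_p x (ha.trans hx.1)) (fun x hx => by
      have hRx := ha.trans hx.1.le
      have hs := (hstep x hx.1.le (hbefore x (Ioo_subset_Ico_self hx))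
        (hpmono x (Ioo_subset_Icc_self hx))).2
      have hw0 : 0 < w x := by linarith [S.le_w x hRx]
      exact div_le_div₀ (by linarith) hs hw0 (S.w_le_w hRx hx.2.le))
  have e2 : w b - w a ≤ 2 * (b - a) :=
    sub_le_of_hasDerivAt_le hab (fun x hx => S.hasDerivAt_w x (ha.trans hx.1)) (fun x hx => by
      linarith [hpb x (Ioo_subset_Icc_self hx)])
  -- In so short a time, `U` cannot climb by `997` at speed at most about `13 / √w`: the time is
  -- below `56 √w` and the speed below `14 / √w`, which allows for a climb of `784`.
  have e3 : U b - U a ≤ (13 / r + 6 / w a) * (b - a) :=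
    sub_le_of_hasDerivAt_le hab (fun x hx => S.hasDerivAt_U x (ha.trans hx.1)) (fun x hx => by
      have hRx := ha.trans hx.1.le
      have h1 := S.deriv_U_le hRx
      have h2 := hpb x (Ioo_subset_Icc_self hx)
      have h3 : 3 / w x ≤ 3 / w a :=
        div_le_div_of_nonneg_left (by norm_num) (by linarith) (S.w_le_w ha hx.1.le)
      have h4 : p x * (3 / w x) ≤ 2 * (3 / w a) :=
        mul_le_mul (by linarith) h3 (by have := S.le_w x hRx; positivity) (by norm_num)
      have h5 : 6 / w a = 2 * (3 / w a) := by ring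
      linarith)
  have hw0 : 0 < w b := by linarith
  have hT : b - a ≤ w b / 10 := by
    have : (3 / 10 / w b) * (b - a) ≤ 3 / 100 := by linarith
    rw [div_mul_eq_mul_div, div_le_iff₀ hw0] at this
    linarith
  have hw2 : w b ≤ 2 * w a := by linarith
  have h3a : 3 / w a ≤ 6 / w b := by
    rw [div_le_div_iff₀ (by linarith) hw0]; linarith
  have hr0 : 0 < r := by linarith
  have hT2 : b - a ≤ 56 * r := by
    have : (3 / 10 / w b) * (b - a) ≤ 13 / r + 6 / w b := by linarith
    rw [← hrr, div_mul_eq_mul_div, div_le_iff₀ (by positivity)] at this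
    have e : (13 / r + 6 / r ^ 2) * r ^ 2 = 13 * r + 6 := by field_simp
    rw [e] at this
    linarith
  have h6 : 13 / r + 6 / w a ≤ 14 / r := by
    have e : 12 / w b = 12 / r / r := by rw [← hrr]; field_simp
    have h7 : 12 / r / r ≤ 1 / r := by
      apply div_le_div_of_nonneg_right _ hr0.le
      rw [div_le_one hr0]; linarith
    have h8 : 6 / w a = 2 * (3 / w a) := by ring
    have h9 : 12 / w b = 2 * (6 / w b) := by ring
    have h10 : 14 / r = 13 / r + 1 / r := by ring
    linarith
  have h7 : (13 / r + 6 / w a) * (b - a) ≤ 14 / r * (56 * r) :=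
    mul_le_mul h6 hT2 (by linarith) (by positivity)
  have h8 : 14 / r * (56 * r) = 784 := by field_simp; norm_num
  linarith

/-- Momentum carries `U` beyond level `3`: as long as `U ≤ 3`, the deceleration of `p` is at most
`6 / w`, so during a time `√w` the speed stays above `(13 - 6) / √w` and `U` climbs by `7`. -/
theorem exists_three_lt (S : IsReducedOrbit w p U h R) {b : ℝ} (hb : R ≤ b) (hUb : -3 ≤ U b)
    (hpb : 13 / √(w b) ≤ p b - 1) : ∃ x, b ≤ x ∧ 3 < U x := by
  by_contra! hle
  have hwb := S.le_w b hb
  set r := √(w b) with hr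
  have hrr : r ^ 2 = w b := sq_sqrt (by linarith)
  have hr0 : 0 < r := sqrt_pos.2 (by linarith)
  have hexp : exp 3 ≤ 24 := by
    have h1 : exp 3 = exp 1 ^ 3 := by rw [← exp_nat_mul]; norm_num
    have h2 := exp_one_lt_d9
    have h3 : exp 1 ^ 3 ≤ 2.8 ^ 3 := pow_le_pow_left₀ (exp_pos 1).le (by linarith) 3
    rw [h1]
    norm_num at h3 ⊢
    linarith
  have hp : ∀ x ∈ Icc b (b + r), 7 / r ≤ p x - 1 := by
    intro x hx
    have := le_sub_of_le_hasDerivAt (C := -6 / w b) hx.1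
      (fun y hy => S.hasDerivAt_p y (hb.trans hy.1)) (fun y hy => ?_)
    · have h1 : -6 / w b * r ≤ -6 / w b * (x - b) :=
        mul_le_mul_of_nonpos_left (by linarith [hx.2])
          (div_nonpos_of_nonpos_of_nonneg (by norm_num) (by linarith))
      have h2 : -6 / w b * r = 7 / r - 13 / r := by rw [← hrr]; field_simp; norm_num
      linarith
    · have hRy := hb.trans hy.1.le
      have h1 := exp_le_exp.2 (hle y hy.1.le)
      have hw := S.w_le_w hb hy.1.le
      have h2 : 0 ≤ h y * p y ^ 2 := mul_nonneg (by linarith [S.le_h y hRy]) (sq_nonneg _)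
      have h3 : -6 / w b ≤ -6 / w y := by
        rw [div_le_div_iff₀ (by linarith) (by linarith)]; linarith
      exact h3.trans (div_le_div_of_nonneg_right (by linarith) (by linarith))
  have hU := le_sub_of_le_hasDerivAt (C := 7 / r) (show b ≤ b + r by linarith)
    (fun y hy => S.hasDerivAt_U y (hb.trans hy.1)) (fun y hy =>
      (hp y (Ioo_subset_Icc_self hy)).trans (S.sub_one_le_deriv_U (hb.trans hy.1.le)))
  have h4 : 7 / r * (b + r - b) = 7 := by field_simp; ring
  linarith [hle (b + r) (by linarith)]

/-- An orbit whose `U` never exceeds `3` cannot have `U ≤ -1000` either: it would swing back up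
beyond `3`. -/
theorem lt_U_of_le_three (S : IsReducedOrbit w p U h R) (hU : ∀ x, R ≤ x → U x ≤ 3) {x : ℝ}
    (hx : R ≤ x) : -1000 < U x := by
  by_contra! hlow
  obtain ⟨a, hxa, hUa, hpa⟩ := S.exists_turning_point hx hlow
  obtain ⟨b, hab, hUb, hpb⟩ := S.exists_fast_ascent (hx.trans hxa) hUa hpa
  have hRb := hx.trans (hxa.trans hab)
  obtain ⟨c, hbc, hc⟩ := S.exists_three_lt hRb hUb hpb
  exact absurd (hU c (hRb.trans hbc)) (not_le.2 hc)

end IsReducedOrbit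

/-! ### Regularity of the nonlinearity near infinity -/

theorem hasDerivAt_of_contDiffOn_two {u : ℝ → ℝ} {a x : ℝ} (hu : ContDiffOn ℝ 2 u (Ioi a))
    (hx : a < x) :
    HasDerivAt u (deriv u x) x ∧ HasDerivAt (deriv u) (deriv (deriv u) x) x := by
  have hmem : Ioi a ∈ 𝓝 x := Ioi_mem_nhds hx
  have h1 : ContDiffOn ℝ 1 (deriv u) (Ioi a) := hu.deriv_of_isOpen isOpen_Ioi (by norm_num)
  exact ⟨((hu.contDiffAt hmem).differentiableAt (by norm_num)).hasDerivAt,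
    ((h1.contDiffAt hmem).differentiableAt (by norm_num)).hasDerivAt⟩

/-- The behaviour of the nonlinearity on `[s₁, ∞)` used for the reduction: `g` and `g'` are
differentiable and positive, and `H` lies between `1/2` and `2`. -/
structure IsRegularFrom (f : ℝ → ℝ) (s₁ : ℝ) : Prop where
  nonneg : 0 ≤ s₁
  hasDerivAt_g : ∀ s, s₁ ≤ s → HasDerivAt (g f) (deriv (g f) s) s
  hasDerivAt_deriv_g : ∀ s, s₁ ≤ s → HasDerivAt (deriv (g f)) (deriv (deriv (g f)) s) s
  g_pos : ∀ s, s₁ ≤ s → 0 < g f s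
  deriv_g_pos : ∀ s, s₁ ≤ s → 0 < deriv (g f) s
  le_H : ∀ s, s₁ ≤ s → 1 / 2 ≤ H f s
  H_le : ∀ s, s₁ ≤ s → H f s ≤ 2

/-- The bounds on `H` come from `1/2 < 1/q ≤ 1`; positivity of `g'` is forced by the strict
inequality in `G2` with `k = 1`. -/
theorem exists_isRegularFrom {f : ℝ → ℝ} {q : ℝ} (hG1 : G1 f q) (hG2 : G2 f) (hq1 : 1 ≤ q)
    (hq2 : q < 2) : ∃ s₁, IsRegularFrom f s₁ := by
  obtain ⟨C, hC, s₀, -, hg, hH⟩ := hG2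
  have hlow : 1 / 2 < 1 / q := one_div_lt_one_div_of_lt (by linarith) hq2
  have hhigh : 1 / q < 2 := by
    rw [div_lt_iff₀ (by linarith)]; linarith
  obtain ⟨s₁, hs₁⟩ := eventually_atTop.1 ((((hG1.tendsto.eventually_const_lt hlow).and
    (hG1.tendsto.eventually_lt_const hhigh)).and hG1.pos).and
      ((eventually_gt_atTop s₀).and (eventually_ge_atTop 0)))
  have hder := fun s (hs : s₁ ≤ s) =>
    hasDerivAt_of_contDiffOn_two (hg.of_le (by norm_num)) (hs₁ s hs).2.1
  refine ⟨s₁, (hs₁ s₁ le_rfl).2.2, fun s hs => (hder s hs).1, fun s hs => (hder s hs).2,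
    fun s hs => (hs₁ s hs).1.2, fun s hs => ?_, fun s hs => (hs₁ s hs).1.1.1.le,
    fun s hs => (hs₁ s hs).1.1.2.le⟩
  have h1 := (abs_nonneg _).trans_lt (hH 1 (by simp) s (hs₁ s hs).2.1)
  rw [pow_one] at h1
  have h2 := pos_of_mul_pos_right h1 hC.le
  exact (div_pos_iff_of_pos_right (hs₁ s hs).1.2).1 h2

namespace IsRegularFrom

variable {f : ℝ → ℝ} {s₁ : ℝ}

theorem deriv_deriv_g (P : IsRegularFrom f s₁) {s : ℝ} (hs : s₁ ≤ s) :
    deriv (deriv (g f)) s = H f s * deriv (g f) s ^ 2 / g f s := by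
  have h1 := (P.g_pos s hs).ne'
  have h2 := (P.deriv_g_pos s hs).ne'
  rw [H]
  field_simp

theorem deriv_g_le (P : IsRegularFrom f s₁) {s t : ℝ} (hs : s₁ ≤ s) (hst : s ≤ t) :
    deriv (g f) s ≤ deriv (g f) t := by
  have := le_sub_of_le_hasDerivAt (C := 0) hst
    (fun x hx => P.hasDerivAt_deriv_g x (hs.trans hx.1)) (fun x hx => by
      have hx' := hs.trans hx.1.le
      rw [P.deriv_deriv_g hx']
      have := P.le_H x hx'
      have := P.g_pos x hx'
      positivity)
  linarith

theorem g_le_sub (P : IsRegularFrom f s₁) {s t : ℝ} (hs : s₁ ≤ s) (hst : s ≤ t) :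
    deriv (g f) s * (t - s) ≤ g f t - g f s :=
  le_sub_of_le_hasDerivAt hst (fun x hx => P.hasDerivAt_g x (hs.trans hx.1))
    (fun _ hx => P.deriv_g_le hs hx.1.le)

theorem g_le (P : IsRegularFrom f s₁) {s t : ℝ} (hs : s₁ ≤ s) (hst : s ≤ t) :
    g f s ≤ g f t := by
  have := P.g_le_sub hs hst
  have := mul_nonneg (P.deriv_g_pos s hs).le (sub_nonneg.2 hst)
  linarith

theorem le_of_g_lt (P : IsRegularFrom f s₁) {s t : ℝ} (ht : s₁ ≤ t) (hst : g f s < g f t) :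
    s ≤ t := by
  by_contra! h
  exact absurd (P.g_le ht h.le) (not_le.2 hst)

theorem tendsto_g (P : IsRegularFrom f s₁) : Tendsto (g f) atTop atTop := by
  refine tendsto_atTop_mono' _ (f₁ := fun s => g f s₁ + deriv (g f) s₁ * (s - s₁)) ?_ ?_
  · filter_upwards [eventually_ge_atTop s₁] with s hs
    linarith [P.g_le_sub le_rfl hs]
  · exact tendsto_atTop_add_const_left _ _
      ((tendsto_atTop_add_const_right _ (-s₁) tendsto_id).const_mul_atTop
        (P.deriv_g_pos s₁ le_rfl))

end IsRegularFrom

/-- The quantity `log (f(s) e^{-ρ} g(s) g'(s))`, which equals `𝓕(s) - ρ` up to the bounded term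
`log (4H)` and the vanishing term `C / g^{1-ε}`. Leaving out `log (4H)` keeps derivatives of `H`
out of the system satisfied along a solution. -/
noncomputable def level (f : ℝ → ℝ) (ρ s : ℝ) : ℝ :=
  g f s - ρ + log (g f s) + log (deriv (g f) s)

theorem IsRegularFrom.level_le {f : ℝ → ℝ} {s₁ : ℝ} (P : IsRegularFrom f s₁) {s t : ℝ}
    (hs : s₁ ≤ s) (hst : s ≤ t) (ρ : ℝ) : level f ρ s ≤ level f ρ t := by
  have h1 := P.g_le hs hst
  have h2 := log_le_log (P.g_pos s hs) h1
  have h3 := log_le_log (P.deriv_g_pos s hs) (P.deriv_g_le hs hst)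
  rw [level, level]
  linarith

/-- Along a distinguished solution the level is eventually bounded by `log 4` plus a vanishing
error: since `y(ρ) ≤ g⁻¹(ρ)` and `g'` is monotone, the asymptotic expansion can be compared with
the level term by term. -/
theorem IsDistinguishedSolution.eventually_level_le {f y : ℝ → ℝ} {q s₁ : ℝ}
    (P : IsRegularFrom f s₁) (hH : Tendsto (H f) atTop (𝓝 (1 / q))) (hq : 1 ≤ q)
    (hy : IsDistinguishedSolution f q y) : ∀ᶠ ρ in atTop, level f ρ (y ρ) ≤ 3 := by
  obtain ⟨⟨-, hytop⟩, γ, ⟨hγtop, hγ⟩, ε, -, hε, ho⟩ := hy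
  have hpow : Tendsto (fun ρ : ℝ => ρ ^ (-1 + ε)) atTop (𝓝 0) := by
    have := tendsto_rpow_neg_atTop (y := 1 - ε) (by linarith)
    simpa [neg_sub, sub_eq_add_neg, add_comm] using this
  have herr := (ho.trans_tendsto hpow).eventually_lt_const (show (0 : ℝ) < 1 / 2 by norm_num)
  have hHq : Tendsto (fun ρ => log (q * H f (γ ρ))) atTop (𝓝 0) := by
    have h1 := ((hH.comp hγtop).const_mul q).log (by
      have : (0 : ℝ) < q := by linarith
      positivity)
    rw [mul_one_div_cancel (by linarith), log_one] at h1
    exact h1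
  have hHq' := hHq.eventually_lt_const (show (0 : ℝ) < 1 / 2 by norm_num)
  filter_upwards [herr, hHq', hγ, hytop.eventually_ge_atTop s₁, hγtop.eventually_ge_atTop s₁,
    tendsto_log_atTop.eventually_ge_atTop (3 - log (deriv (g f) s₁)), eventually_gt_atTop 0]
    with ρ h1 h2 h3 h4 h5 h6 hρ
  have hg' := P.deriv_g_pos _ h5
  rw [h3, log_div hρ.ne' hg'.ne'] at h1
  have hlogq := log_nonneg hq
  have hlog4 : log 4 ≤ 2 := by
    have : log 4 = 2 * log 2 := by
      rw [show (4 : ℝ) = 2 ^ 2 by norm_num, log_pow]; norm_num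
    linarith [log_two_lt_d9]
  have hm := log_le_log (P.deriv_g_pos _ le_rfl) (P.deriv_g_le le_rfl h5)
  -- `g(y) < ρ = g(γ(ρ))`, so `y(ρ) ≤ γ(ρ)` and `g'` may be compared at these two points.
  have hlt : g f (y ρ) < ρ := by linarith
  have hle : y ρ ≤ γ ρ := P.le_of_g_lt h5 (by rwa [h3])
  have h7 := log_le_log (P.g_pos _ h4) hlt.le
  have h8 := log_le_log (P.deriv_g_pos _ h4) (P.deriv_g_le h4 hle)
  rw [level]
  linarith

/-! ### Singular solutions as orbits of the reduced system -/

/-- A concave function tending to infinity has positive derivative. -/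
theorem deriv_pos_of_concave_of_tendsto {z : ℝ → ℝ} {R x : ℝ}
    (hz : ∀ x, R ≤ x → HasDerivAt z (deriv z x) x)
    (hz' : ∀ x, R ≤ x → HasDerivAt (deriv z) (deriv (deriv z) x) x)
    (hneg : ∀ x, R ≤ x → deriv (deriv z) x ≤ 0) (htop : Tendsto z atTop atTop) (hx : R ≤ x) :
    0 < deriv z x := by
  by_contra! hle
  have h1 : ∀ t, x ≤ t → deriv z t ≤ 0 := by
    intro t ht
    have := sub_le_of_hasDerivAt_le (C := 0) ht (fun s hs => hz' s (hx.trans hs.1))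
      (fun s hs => hneg s (hx.trans hs.1.le))
    linarith
  obtain ⟨t, ht1, ht2⟩ := ((htop.eventually_gt_atTop (z x)).and (eventually_ge_atTop x)).exists
  have := sub_le_of_hasDerivAt_le (C := 0) ht2 (fun s hs => hz s (hx.trans hs.1))
    (fun s hs => h1 s hs.1.le)
  linarith

/-- Here `w' = p` and the equation for `p'` follow from `g'' = H g'² / g` and from
`exp (level f ρ (z ρ)) = f(z) e^{-ρ} g(z) g'(z)`, which is `-4 z'' g(z) g'(z)`. -/
theorem IsSingularSolution.eventually_isReducedOrbit {f z : ℝ → ℝ} {s₁ : ℝ}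
    (hf : IsNonlinearity f) (P : IsRegularFrom f s₁) (hz : IsSingularSolution f z) :
    ∀ᶠ R in atTop, IsReducedOrbit (fun ρ => g f (z ρ)) (fun ρ => deriv (g f) (z ρ) * deriv z ρ)
      (fun ρ => level f ρ (z ρ)) (fun ρ => H f (z ρ)) R := by
  obtain ⟨⟨Λ, hC2, hode⟩, htop⟩ := hz
  obtain ⟨R₀, hR₀⟩ := eventually_atTop.1 (((eventually_gt_atTop Λ).and
    (htop.eventually_ge_atTop s₁)).and
      ((P.tendsto_g.comp htop).eventually_ge_atTop (10 ^ 6)))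
  filter_upwards [eventually_ge_atTop R₀] with R hR
  have hder := fun x (hx : R ≤ x) => hasDerivAt_of_contDiffOn_two hC2 (hR₀ x (hR.trans hx)).1.1
  have hs : ∀ x, R ≤ x → s₁ ≤ z x := fun x hx => (hR₀ x (hR.trans hx)).1.2
  have hfpos : ∀ x, R ≤ x → 0 < f (z x) := fun x hx => hf.pos _ (P.nonneg.trans (hs x hx))
  have hz'' : ∀ x, R ≤ x → deriv (deriv z) x = -(1 / 4 * f (z x) * exp (-x)) := fun x hx => by
    linarith [hode x (hR₀ x (hR.trans hx)).1.1]
  have hz' : ∀ x, R ≤ x → 0 < deriv z x := fun x hx =>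
    deriv_pos_of_concave_of_tendsto (fun x hx => (hder x hx).1) (fun x hx => (hder x hx).2)
      (fun x hx => by
        rw [hz'' x hx]
        have := hfpos x hx
        exact neg_nonpos.2 (by positivity)) htop hx
  have hw : ∀ x, R ≤ x → HasDerivAt (fun ρ => g f (z ρ)) (deriv (g f) (z x) * deriv z x) x :=
    fun x hx => (P.hasDerivAt_g _ (hs x hx)).comp x (hder x hx).1
  have hg' : ∀ x, R ≤ x → HasDerivAt (fun ρ => deriv (g f) (z ρ))
      (deriv (deriv (g f)) (z x) * deriv z x) x :=
    fun x hx => (P.hasDerivAt_deriv_g _ (hs x hx)).comp x (hder x hx).1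
  refine ⟨hw, fun x hx => ?_, fun x hx => ?_, fun x hx => P.le_H _ (hs x hx),
    fun x hx => P.H_le _ (hs x hx), fun x hx => (hR₀ x (hR.trans hx)).2,
    fun x hx => mul_pos (P.deriv_g_pos _ (hs x hx)) (hz' x hx), P.tendsto_g.comp htop⟩
  · have hgp := P.g_pos _ (hs x hx)
    have hgp' := P.deriv_g_pos _ (hs x hx)
    have hexp : exp (level f x (z x))
        = f (z x) * exp (-x) * g f (z x) * deriv (g f) (z x) := by
      rw [level, sub_eq_add_neg, exp_add, exp_add, exp_add, exp_log hgp, exp_log hgp', g,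
        exp_log (hfpos x hx)]
    refine ((hg' x hx).mul (hder x hx).2).congr_deriv ?_
    rw [hexp, hz'' x hx, P.deriv_deriv_g (hs x hx)]
    field_simp
    ring
  · have hgp := P.g_pos _ (hs x hx)
    have hgp' := P.deriv_g_pos _ (hs x hx)
    refine ((((hw x hx).sub (hasDerivAt_id x)).add ((hw x hx).log hgp.ne')).add
      ((hg' x hx).log hgp'.ne')).congr_deriv ?_
    rw [P.deriv_deriv_g (hs x hx)]
    field_simp
    ring

/-- The constant `4` absorbs `log (4H) ≤ log 8` and the vanishing term `C / g^{1-ε}`. -/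
theorem IsRegularFrom.eventually_level_sub_le {f z : ℝ → ℝ} {s₁ ε : ℝ} (P : IsRegularFrom f s₁)
    (hz : Tendsto z atTop atTop) (hε : ε < 1) (C : ℝ) :
    ∀ᶠ ρ in atTop, level f ρ (z ρ) - 4 ≤ F f ε C (z ρ) - ρ := by
  have hC : Tendsto (fun ρ => C / g f (z ρ) ^ (1 - ε)) atTop (𝓝 0) :=
    ((tendsto_rpow_atTop (by linarith)).comp (P.tendsto_g.comp hz)).const_div_atTop C
  filter_upwards [hC.eventually_lt_const (zero_lt_one), hz.eventually_ge_atTop s₁] with ρ h1 h2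
  have h3 : log (4 * H f (z ρ)) ≤ log (2 ^ 3) :=
    log_le_log (by linarith [P.le_H _ h2]) (by linarith [P.H_le _ h2])
  rw [log_pow] at h3
  rw [F, level, log_div (P.g_pos _ h2).ne' (P.deriv_g_pos _ h2).ne']
  push_cast at h3
  linarith [log_two_lt_d9]

end EmdenFowler

theorem theorem4p1 (f : ℝ → ℝ) (q : ℝ) (hf : EmdenFowler.IsNonlinearity f)
    (hG1 : EmdenFowler.G1 f q) (hG2 : EmdenFowler.G2 f) (hq1 : 1 ≤ q) (hq2 : q < 2) :
    ∃ C₁ : ℝ, 0 < C₁ ∧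
      ∀ ε : ℝ, 0 < ε → ε < 1 → ∀ C : ℝ, 0 < C →
      ∀ y z : ℝ → ℝ, EmdenFowler.IsDistinguishedSolution f q y →
        EmdenFowler.IsSingularSolution f z →
        (∃ ρ : ℕ → ℝ, Tendsto ρ atTop atTop ∧
          ∀ n, EmdenFowler.g f (y (ρ n)) ≤ EmdenFowler.g f (z (ρ n))) ∨
        (∀ᶠ ρ in atTop, EmdenFowler.F f ε C (z ρ) - ρ > -C₁) ∨
        (∃ ρ : ℕ → ℝ, Tendsto ρ atTop atTop ∧
          ∀ n, EmdenFowler.F f ε C (z (ρ n)) > ρ n ∧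
            ρ n ≥ EmdenFowler.F f ε C (y (ρ n))) := by
  obtain ⟨s₁, P⟩ := EmdenFowler.exists_isRegularFrom hG1 hG2 hq1 hq2
  refine ⟨1004, by norm_num, fun ε _ hε C _ y z hy hz => ?_⟩
  by_cases hfreq : ∃ᶠ ρ in atTop, EmdenFowler.g f (y ρ) ≤ EmdenFowler.g f (z ρ)
  · obtain ⟨ρ, hρ, hle⟩ := exists_seq_forall_of_frequently hfreq
    exact Or.inl ⟨ρ, hρ, hle⟩
  · right; left
    rw [not_frequently] at hfreq
    have hlevel : ∀ᶠ ρ in atTop, EmdenFowler.level f ρ (z ρ) ≤ 3 := by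
      filter_upwards [hfreq, hy.eventually_level_le P hG1.tendsto hq1,
        hz.2.eventually_ge_atTop s₁, hy.1.2.eventually_ge_atTop s₁] with ρ h1 h2 h3 h4
      exact (P.level_le h3 (P.le_of_g_lt h4 (not_le.1 h1)) ρ).trans h2
    obtain ⟨R₀, hR₀⟩ := eventually_atTop.1 hlevel
    obtain ⟨R, S, hR⟩ := ((hz.eventually_isReducedOrbit hf P).and (eventually_ge_atTop R₀)).exists
    filter_upwards [P.eventually_level_sub_le hz.2 hε C, eventually_ge_atTop R] with ρ h1 h2
    linarith [S.lt_U_of_le_three (fun x hx => hR₀ x (hR.trans hx)) h2]
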